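/- Let $G$ be a finite group with identity $e$. For $X\subseteq G$ put $\underline{X}=\sum_{x\in X}x\in\mathbb{Z}G$. A Schur ring (S-ring) over $G$ is a subring $\mathcal{A}$ of the group ring $\mathbb{Z}G$ for which there is a partition $\mathcal{S}$ of $G$ such that $\{e\}\in\mathcal{S}$, $X\in\mathcal{S}$ implies $X^{-1}\in\mathcal{S}$, and $\mathcal{A}$ is the $\mathbb{Z}$-span of $\{\underline{X}: X\in\mathcal{S}\}$. It is central if it is contained in the center $\mathcal{Z}(\mathbb{Z}G)$ of $\mathbb{Z}G$. A central S-ring is proper if it lies strictly between the trivial S-ring $\mathbb{Z}e+\mathbb{Z}\underline{G}$ and $\mathcal{Z}(\mathbb{Z}G)$. An S-ring $\mathcal{A}$ is primitive if $\{e\}$ and $G$ are the only subgroups of $G$ that are unions of classes of $\mathcal{S}$. The group $G$ is a generalized B-group if no proper central S-ring over $G$ is primitive. The group $G$ is a Frobenius group if it has a subgroup $H$ with $\{e\}\neq H\neq G$ and $H\cap gHg^{-1}=\{e\}$ for all $g\in G\setminus H$. It is extra-special if, for some prime $p$, it is a $p$-group whose center $Z(G)$ has order $p$ and whose quotient $G/Z(G)$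 is a nontrivial elementary abelian $p$-group. Corollary. Every finite Frobenius group and every extra-special group is a generalized B-group. -/

import Mathlib

open scoped Pointwise

/-- The element `∑ x ∈ X, x` of the integral group ring `ℤG`. -/
noncomputable def groupRingSum {G : Type*} [Group G] (X : Finset G) : MonoidAlgebra ℤ G :=
  ∑ x ∈ X, MonoidAlgebra.of ℤ G x

/-- A Schur ring over a finite group `G`: a subring of `ℤG` together with the partition of `G`
into its basic sets. -/
structure SchurRing (G : Type*) [Group G] [Fintype G] [DecidableEq G] where
  /-- the underlying subring of the group ring -/
  toSubring : Subring (MonoidAlgebra ℤ G)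
  /-- the partition of `G` into basic sets -/
  basicSets : Finpartition (Finset.univ : Finset G)
  one_mem : {1} ∈ basicSets.parts
  inv_mem : ∀ X ∈ basicSets.parts, X⁻¹ ∈ basicSets.parts
  span_eq : (Submodule.span ℤ {a | ∃ X ∈ basicSets.parts, a = groupRingSum X} :
    Set (MonoidAlgebra ℤ G)) = toSubring

namespace SchurRing

variable {G : Type*} [Group G] [Fintype G] [DecidableEq G]

/-- An `A`-set: a union of basic sets of `A`. -/
def IsASet (A : SchurRing G) (X : Set G) : Prop :=
  ∃ T ⊆ A.basicSets.parts, X = ⋃ Y ∈ T, (Y : Set G)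

/-- `A` is primitive if its only `A`-subgroups are the trivial subgroup and `G`. -/
def IsPrimitive (A : SchurRing G) : Prop :=
  ∀ H : Subgroup G, A.IsASet (H : Set G) → H = ⊥ ∨ H = ⊤

/-- `A` is central if it is contained in the center of `ℤG`. -/
def IsCentral (A : SchurRing G) : Prop :=
  A.toSubring ≤ Subring.center (MonoidAlgebra ℤ G)

/-- A central Schur ring is proper if it lies strictly between the trivial Schur ring
`ℤe + ℤ(∑ g, g)` and the center of `ℤG`. -/
def IsProper (A : SchurRing G) : Prop :=
  (Submodule.span ℤ {1, groupRingSum (Finset.univ : Finset G)} : Set (MonoidAlgebra ℤ G)) ⊂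
      (A.toSubring : Set (MonoidAlgebra ℤ G)) ∧
    A.toSubring < Subring.center (MonoidAlgebra ℤ G)

end SchurRing

/-- A finite group is a generalized B-group if no proper central Schur ring over it is
primitive. -/
def IsGeneralizedBGroup (G : Type*) [Group G] [Fintype G] [DecidableEq G] : Prop :=
  ∀ A : SchurRing G, A.IsCentral → A.IsProper → ¬ A.IsPrimitive

/-- A (finite) group is a Frobenius group if it has a Frobenius complement: a proper nontrivial
subgroup `H` with `H ∩ gHg⁻¹ = 1` for every `g ∉ H`. -/
def IsFrobeniusGroup (G : Type*) [Group G] : Prop :=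
  ∃ H : Subgroup G, H ≠ ⊥ ∧ H ≠ ⊤ ∧
    ∀ g : G, g ∉ H → ∀ x ∈ H, g * x * g⁻¹ ∈ H → x = 1

/-- A (finite) group is extra-special if, for some prime `p`, it is a `p`-group whose center has
order `p` and whose central quotient is a nontrivial elementary abelian `p`-group. -/
def IsExtraSpecial (G : Type*) [Group G] : Prop :=
  ∃ p : ℕ, p.Prime ∧ IsPGroup p G ∧ Nat.card (Subgroup.center G) = p ∧
    Nontrivial (G ⧸ Subgroup.center G) ∧
    (∀ x y : G ⧸ Subgroup.center G, x * y = y * x) ∧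
    ∀ x : G ⧸ Subgroup.center G, x ^ p = 1

/-! Both families have a Camina kernel `N`, and a Camina kernel rules out proper primitive central
S-rings. For extra-special groups `N` is the center: commutation with a noncentral element maps `G`
onto it. For Frobenius groups `N` is the Frobenius kernel, which is a subgroup by Frobenius's
theorem: characters of the complement extend to `G`, and the kernels of the extensions intersect in
`N`. A nontrivial element of a conjugate of the complement centralizes only 1 in `N`, so its
commutators with `N` fill `N`. Basic sets of a central S-ring are unions of conjugacy classes, hence
unions of `N`-cosets outside `N`. Under primitivity every nontrivial basic set meets both `N` and
its complement (`exists_mem_mem`, `exists_mem_notMem`). Comparing a structure constant at a point of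
`X` inside `N` and one outside (`inv_mul_mem`) forces all nontrivial basic sets to coincide, so the
S-ring is trivial. -/

namespace Representation

open Module

/-! ### Complex characters of finite groups -/

section Character

variable {G V : Type*} [Group G] [AddCommGroup V] [Module ℂ V] [FiniteDimensional ℂ V]

open scoped ComplexOrder in
/-- Complex characters of finite groups satisfy `χ(g⁻¹) = conj χ(g)`: the representation is
unitary for the average of any inner product. -/
theorem char_inv_eq_conj [Finite G] (ρ : Representation ℂ G V) (g : G) :
    ρ.character g⁻¹ = (starRingEnd ℂ) (ρ.character g) := by
  classical
  have := Fintype.ofFinite G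
  let b := finBasis ℂ V
  let A : G → Matrix _ _ ℂ := fun x => LinearMap.toMatrix b b (ρ x)
  have hA1 : A 1 = 1 := by simp [A]
  have hmul (x y : G) : A (x * y) = A x * A y := by
    simp only [A, map_mul, LinearMap.toMatrix_mul]
  have hchar (x : G) : ρ.character x = (A x).trace :=
    LinearMap.trace_eq_matrix_trace ℂ b (ρ x)
  let S : Matrix _ _ ℂ := ∑ x : G, (A x).conjTranspose * A x
  have hS : S.PosDef := by
    have : S = (A 1).conjTranspose * A 1 +
        ∑ x ∈ Finset.univ.erase (1 : G), (A x).conjTranspose * A x :=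
      (Finset.add_sum_erase _ (fun x => (A x).conjTranspose * A x) (Finset.mem_univ _)).symm
    rw [this, hA1]
    refine Matrix.PosDef.add_posSemidef ?_ ?_
    · simpa using Matrix.PosDef.one
    · exact Matrix.posSemidef_sum _ fun x _ => Matrix.posSemidef_conjTranspose_mul_self _
  have hinv : (A g).conjTranspose * S * A g = S := by
    simp only [S, Finset.mul_sum, Finset.sum_mul]
    refine Fintype.sum_equiv (Equiv.mulRight g) _ _ fun x => ?_
    simp [hmul, Matrix.conjTranspose_mul, Matrix.mul_assoc]
  have hgg : A g * A g⁻¹ = 1 := by rw [← hmul, mul_inv_cancel, hA1]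
  have hdet : IsUnit S.det := (Matrix.isUnit_iff_isUnit_det S).mp hS.isUnit
  -- Invariance of the form `S` makes the adjoint of `A g` similar to `A g⁻¹`, so their traces
  -- agree.
  have hconj : (A g).conjTranspose = S * A g⁻¹ * S⁻¹ := by
    have h1 : (A g).conjTranspose * S = S * A g⁻¹ := by
      calc (A g).conjTranspose * S = (A g).conjTranspose * S * (A g * A g⁻¹) := by
            rw [hgg, Matrix.mul_one]
        _ = S * A g⁻¹ := by rw [← Matrix.mul_assoc, hinv]
    rw [← h1, Matrix.mul_assoc, Matrix.mul_nonsing_inv _ hdet, Matrix.mul_one]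
  rw [hchar, hchar, starRingEnd_apply, ← Matrix.trace_conjTranspose, hconj, Matrix.trace_mul_comm,
    ← Matrix.mul_assoc, Matrix.nonsing_inv_mul _ hdet, Matrix.one_mul]

theorem char_eq_add_of_isCompl (ρ : Representation ℂ G V) {U W : Subrepresentation ρ}
    (h : IsCompl U W) (g : G) :
    ρ.character g = U.toRepresentation.character g + W.toRepresentation.character g := by
  have hc : IsCompl U.toSubmodule W.toSubmodule := by
    constructor
    · rw [disjoint_iff]
      exact congrArg Subrepresentation.toSubmodule h.inf_eq_bot
    · rw [codisjoint_iff]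
      exact congrArg Subrepresentation.toSubmodule h.sup_eq_top
  let N : Bool → Submodule ℂ V := fun i => bif i then U.toSubmodule else W.toSubmodule
  have hN : DirectSum.IsInternal N :=
    (DirectSum.isInternal_submodule_iff_isCompl N (i := true) (j := false) (by simp)
      (by ext i; cases i <;> simp)).2 hc
  have hmaps : ∀ i, Set.MapsTo (ρ g) (N i) (N i) := by
    intro i v hv
    cases i
    · exact W.apply_mem_toSubmodule g hv
    · exact U.apply_mem_toSubmodule g hv
  have := LinearMap.trace_eq_sum_trace_restrict hN hmaps
  rw [Fintype.sum_bool] at this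
  exact this

end Character

section Irreducible

universe u

variable {G : Type u} [Group G] [Fintype G]

theorem exists_complement (V : Type*) [AddCommGroup V] [Module ℂ V] (ρ : Representation ℂ G V)
    (U : Subrepresentation ρ) : ∃ W, IsCompl U W := by
  have : IsSemisimpleRepresentation ρ := by
    rw [isSemisimpleRepresentation_iff_isSemisimpleModule_asModule]
    infer_instance
  exact exists_isCompl U

/-- A linear functional that does not vanish on some character does not vanish on some
irreducible character. -/
theorem exists_isIrreducible_sum_ne_zero (c : G → ℂ) {V : Type u} [AddCommGroup V] [Module ℂ V]
    [FiniteDimensional ℂ V] (ρ : Representation ℂ G V) (hρ : ∑ g, c g * ρ.character g ≠ 0) :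
    ∃ (W : Type u) (_ : AddCommGroup W) (_ : Module ℂ W) (_ : FiniteDimensional ℂ W)
      (σ : Representation ℂ G W), σ.IsIrreducible ∧ ∑ g, c g * σ.character g ≠ 0 := by
  induction hn : finrank ℂ V using Nat.strong_induction_on generalizing V with
  | _ n ih =>
    by_cases hirr : ρ.IsIrreducible
    · exact ⟨V, _, _, inferInstance, ρ, hirr, hρ⟩
    have hnt : Nontrivial V := by
      by_contra hV
      rw [not_nontrivial_iff_subsingleton] at hV
      refine hρ (Finset.sum_eq_zero fun g _ => ?_)
      have : ρ g = 0 := Subsingleton.elim _ _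
      simp [character, this]
    have hnt' : Nontrivial (Subrepresentation ρ) := by
      refine ⟨⊥, ⊤, fun h => ?_⟩
      exact bot_ne_top (congrArg Subrepresentation.toSubmodule h : (⊥ : Submodule ℂ V) = ⊤)
    obtain ⟨U, hU⟩ : ∃ U : Subrepresentation ρ, ¬ (U = ⊥ ∨ U = ⊤) := by
      by_contra! h
      exact hirr ⟨h⟩
    rw [not_or] at hU
    obtain ⟨W, hUW⟩ := exists_complement V ρ U
    have hW : W ≠ ⊤ := by
      rintro rfl
      exact hU.1 (by simpa using hUW.inf_eq_bot)
    have hlt (X : Subrepresentation ρ) (hX : X ≠ ⊤) : finrank ℂ X.toSubmodule < n := by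
      rw [← hn]
      exact Submodule.finrank_lt fun h => hX (Subrepresentation.toSubmodule_injective h)
    have hsum : ∑ g, c g * U.toRepresentation.character g +
        ∑ g, c g * W.toRepresentation.character g ≠ 0 := by
      rw [← Finset.sum_add_distrib]
      simpa only [char_eq_add_of_isCompl ρ hUW, mul_add] using hρ
    by_cases h0 : ∑ g, c g * U.toRepresentation.character g = 0
    · rw [h0, zero_add] at hsum
      exact ih _ (hlt W hW) W.toRepresentation hsum rfl
    · exact ih _ (hlt U hU.2) U.toRepresentation h0 rfl

/-- Translation by `g` permutes the basis, without fixed points unless `g = 1`. -/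
theorem char_leftRegular [DecidableEq G] (g : G) :
    (leftRegular ℂ G).character g = if g = 1 then (Fintype.card G : ℂ) else 0 := by
  let b : Basis G ℂ (MonoidAlgebra ℂ G) := Basis.ofRepr (MonoidAlgebra.coeffLinearEquiv ℂ)
  have hb (x : G) : b x = MonoidAlgebra.single x 1 := rfl
  rw [character, LinearMap.trace_eq_matrix_trace ℂ b, Matrix.trace]
  have (x : G) : (LinearMap.toMatrix b b (leftRegular ℂ G g)).diag x = if g = 1 then 1 else 0 := by
    rw [Matrix.diag_apply, LinearMap.toMatrix_apply, hb, ofMulAction_single]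
    change (MonoidAlgebra.single (g • x) (1 : ℂ)).coeff x = _
    simp [Finsupp.single_apply]
  simp only [this]
  split_ifs <;> simp

/-- A functional `∑ g, c g * χ(g)` with `c 1 ≠ 0` does not vanish on some irreducible character. -/
theorem exists_isIrreducible_sum_ne_zero_of_ne_zero (c : G → ℂ) (hc : c 1 ≠ 0) :
    ∃ (W : Type u) (_ : AddCommGroup W) (_ : Module ℂ W) (_ : FiniteDimensional ℂ W)
      (σ : Representation ℂ G W), σ.IsIrreducible ∧ ∑ g, c g * σ.character g ≠ 0 := by
  classical
  let e : MonoidAlgebra ℂ G ≃ₗ[ℂ] (G →₀ ℂ) := MonoidAlgebra.coeffLinearEquiv ℂ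
  have : FiniteDimensional ℂ (MonoidAlgebra ℂ G) := Module.Finite.equiv e.symm
  refine exists_isIrreducible_sum_ne_zero c (leftRegular ℂ G) ?_
  simp [char_leftRegular, hc]

/-- The functional `χ 1 - χ h` has coefficient 1 at the identity. -/
theorem exists_isIrreducible_char_ne {h : G} (hh : h ≠ 1) :
    ∃ (W : Type u) (_ : AddCommGroup W) (_ : Module ℂ W) (_ : FiniteDimensional ℂ W)
      (σ : Representation ℂ G W), σ.IsIrreducible ∧ σ.character h ≠ σ.character 1 := by
  classical
  obtain ⟨W, i1, i2, i3, σ, hσ, hne⟩ := exists_isIrreducible_sum_ne_zero_of_ne_zero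
    (fun g : G => (if g = 1 then 1 else 0) - (if g = h then 1 else 0) : G → ℂ)
    (by simp [hh.symm])
  refine ⟨W, i1, i2, i3, σ, hσ, fun heq => hne ?_⟩
  simp [sub_mul, Finset.sum_sub_distrib, heq]

/-- A class function of norm one, all of whose inner products with irreducible characters are
integers and whose value at the identity is positive, is an irreducible character. -/
theorem exists_char_eq_of_norm_one (F : G → ℂ) (hconj : ∀ g, F g⁻¹ = (starRingEnd ℂ) (F g))
    (hnorm : ∑ g, F g * F g⁻¹ = Fintype.card G) (d : ℕ) (hd : d ≠ 0) (hF1 : F 1 = d)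
    (hint : ∀ (W : Type u) [AddCommGroup W] [Module ℂ W] [FiniteDimensional ℂ W]
      (σ : Representation ℂ G W), ∃ n : ℤ, ∑ g, F g * σ.character g⁻¹ = n * Fintype.card G) :
    ∃ (W : Type u) (_ : AddCommGroup W) (_ : Module ℂ W) (_ : FiniteDimensional ℂ W)
      (σ : Representation ℂ G W), ∀ g, σ.character g = F g := by
  -- Some irreducible `σ` is not orthogonal to `F`; the rest shows that `F` is its character.
  obtain ⟨W, i1, i2, i3, σ, hσ, hne⟩ := exists_isIrreducible_sum_ne_zero_of_ne_zero
    (fun g : G => F g⁻¹) (by simp [hF1, hd])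
  refine ⟨W, i1, i2, i3, σ, ?_⟩
  have hcard : (Fintype.card G : ℂ) ≠ 0 := by simp
  have hinv (a b : G → ℂ) : ∑ g, a g⁻¹ * b g = ∑ g, b g * a g⁻¹ :=
    Finset.sum_congr rfl fun _ _ => mul_comm _ _
  have hswap (a b : G → ℂ) : ∑ g, a g * b g⁻¹ = ∑ g, b g * a g⁻¹ :=
    Fintype.sum_equiv (Equiv.inv G) _ _ fun g => by simp [mul_comm]
  obtain ⟨n, hn⟩ := hint W σ
  have hn0 : n ≠ 0 := by
    rintro rfl
    apply hne
    rw [hinv F, hswap, hn]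
    simp
  have hχ : ∑ g, σ.character g * σ.character g⁻¹ = Fintype.card G := by
    have : Invertible (Nat.card G : ℂ) := invertibleOfNonzero (by simp)
    have := char_orthonormal σ σ
    rw [if_pos ⟨Equiv.refl σ⟩, Nat.card_eq_fintype_card, inv_mul_eq_iff_eq_mul₀ hcard] at this
    simpa using this
  have hsq (e : ℂ) : ∑ g, (F g + e * σ.character g) * (F g⁻¹ + e * σ.character g⁻¹) =
      (1 + 2 * e * n + e ^ 2) * Fintype.card G := by
    have h (g : G) : (F g + e * σ.character g) * (F g⁻¹ + e * σ.character g⁻¹) =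
        F g * F g⁻¹ + e * (F g * σ.character g⁻¹) + e * (σ.character g * F g⁻¹) +
          e ^ 2 * (σ.character g * σ.character g⁻¹) := by ring
    simp only [h, Finset.sum_add_distrib, ← Finset.mul_sum]
    rw [hnorm, hswap σ.character F, hn, hχ]
    ring
  have hreal (e : ℤ) : ∑ g, Complex.normSq (F g + e * σ.character g) =
      (1 + 2 * e * n + e ^ 2) * Fintype.card G := by
    have := hsq e
    have h (g : G) : F g⁻¹ + e * σ.character g⁻¹ =
        (starRingEnd ℂ) (F g + e * σ.character g) := by
      simp [hconj, char_inv_eq_conj]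
    simp only [h, Complex.mul_conj] at this
    exact_mod_cast this
  have hcardpos : (0 : ℝ) < Fintype.card G := by exact_mod_cast Fintype.card_pos
  have hpos (e : ℤ) : 0 ≤ 1 + 2 * e * n + e ^ 2 := by
    have h0 : 0 ≤ ∑ g, Complex.normSq (F g + e * σ.character g) :=
      Finset.sum_nonneg fun g _ => Complex.normSq_nonneg _
    rw [hreal] at h0
    have := nonneg_of_mul_nonneg_left h0 hcardpos
    exact_mod_cast this
  have hzero (e : ℤ) (he : 1 + 2 * e * n + e ^ 2 = 0) (g : G) : F g + e * σ.character g = 0 := by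
    have h0 : ∑ g, Complex.normSq (F g + e * σ.character g) = 0 := by
      rw [hreal]
      have : (1 + 2 * e * n + e ^ 2 : ℝ) = 0 := by exact_mod_cast he
      rw [this, zero_mul]
    rw [Finset.sum_eq_zero_iff_of_nonneg fun g _ => Complex.normSq_nonneg _] at h0
    exact Complex.normSq_eq_zero.1 (h0 g (Finset.mem_univ g))
  have h1 := hpos 1
  have h2 := hpos (-1)
  -- The squared norms `2 ± 2n` of `F ± σ` are nonnegative, so `|n| ≤ 1`. Equality makes one of them
  -- vanish; `F = -σ` is excluded by the values at 1.
  obtain rfl | rfl : n = 1 ∨ n = -1 := by omega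
  · intro g
    have := hzero (-1) (by norm_num) g
    push_cast at this
    linear_combination -this
  · exfalso
    have := hzero 1 (by norm_num) 1
    rw [hF1, char_one] at this
    have h : d + finrank ℂ W = 0 := by
      push_cast at this
      rw [one_mul] at this
      exact_mod_cast this
    omega

end Irreducible

end Representation

/-- `N` is a Camina kernel of `G` if it is a nontrivial proper normal subgroup such that each
coset `N * x` with `x ∉ N` consists of conjugates of `x`. -/
structure IsCaminaKernel {G : Type*} [Group G] (N : Subgroup G) : Prop where
  normal : N.Normal
  ne_bot : N ≠ ⊥
  ne_top : N ≠ ⊤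
  isConj : ∀ x ∉ N, ∀ n ∈ N, IsConj x (n * x)

/-! ### Frobenius's theorem by induced characters -/

namespace Frobenius

open Module Representation

universe u

variable {G : Type u} [Group G] [Fintype G] {H : Subgroup G}

/-- Induction to `G` of a function `f` on `G` that vanishes off the subgroup `H`. -/
noncomputable def ind (H : Subgroup G) (f : G → ℂ) (g : G) : ℂ :=
  (Nat.card H : ℂ)⁻¹ * ∑ x : G, f (x⁻¹ * g * x)

theorem ind_conj (f : G → ℂ) (g y : G) : ind H f (y * g * y⁻¹) = ind H f g := by
  unfold ind
  congr 1
  refine Fintype.sum_equiv (Equiv.mulLeft y⁻¹) _ _ fun x => ?_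
  simp [mul_assoc]

/-- Frobenius reciprocity for functions. -/
theorem sum_ind_mul (f χ : G → ℂ) (hχ : ∀ g y, χ (y * g * y⁻¹) = χ g) :
    ∑ g, ind H f g * χ g⁻¹ = (Nat.card H : ℂ)⁻¹ * Fintype.card G * ∑ g, f g * χ g⁻¹ := by
  have h (x : G) : ∑ g, f (x⁻¹ * g * x) * χ g⁻¹ = ∑ g, f g * χ g⁻¹ := by
    refine Fintype.sum_equiv (MulAut.conj x⁻¹).toEquiv _ _ fun g => ?_
    have := hχ g⁻¹ x⁻¹
    simp only [inv_inv] at this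
    simp only [mul_assoc] at this
    simp [mul_assoc, this]
  simp only [ind, mul_assoc (Nat.card H : ℂ)⁻¹, Finset.sum_mul, ← Finset.mul_sum]
  rw [Finset.sum_comm, Finset.sum_congr rfl fun x _ => h x]
  simp

/-- The malnormality condition defining Frobenius complements. -/
def IsMalnormal (H : Subgroup G) : Prop :=
  ∀ g : G, g ∉ H → ∀ x ∈ H, g * x * g⁻¹ ∈ H → x = 1

/-- For `1 ≠ h ∈ H`, malnormality leaves only the terms with `x ∈ H`, each equal to `f h`. At 1
every term is `f 1 = 0`. -/
theorem ind_apply_of_mem (hH : IsMalnormal H) {f : G → ℂ} (hf : ∀ x ∉ H, f x = 0) (hf1 : f 1 = 0)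
    (hfc : ∀ y ∈ H, ∀ x, f (y * x * y⁻¹) = f x) {h : G} (hh : h ∈ H) : ind H f h = f h := by
  classical
  by_cases h1 : h = 1
  · simp [ind, h1, hf1]
  have hx (x : G) : f (x⁻¹ * h * x) = if x ∈ H then f h else 0 := by
    split_ifs with hxH
    · simpa using hfc x⁻¹ (H.inv_mem hxH) h
    · refine hf _ fun hmem => h1 (hH x⁻¹ (by simpa using hxH) h hh (by simpa using hmem))
  have hc : (Nat.card H : ℂ) ≠ 0 := by simp
  have hcard : (Finset.univ.filter (· ∈ H)).card = Nat.card H := by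
    rw [Nat.card_eq_fintype_card, Fintype.card_subtype]
  rw [ind, Finset.sum_congr rfl fun x _ => hx x, ← Finset.sum_filter, Finset.sum_const, hcard,
    nsmul_eq_mul, inv_mul_cancel_left₀ hc]

theorem ind_apply_of_forall {f : G → ℂ} (hf : ∀ x ∉ H, f x = 0) {g : G}
    (hg : ∀ x, x⁻¹ * g * x ∉ H) : ind H f g = 0 := by
  simp [ind, hf _ (hg _)]

/-- Every irreducible character `φ` of a Frobenius complement extends to a character of the group
that takes the value `φ 1` outside the conjugates of the complement. -/
theorem exists_char_extension (hH : IsMalnormal H) {V : Type u} [AddCommGroup V] [Module ℂ V]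
    [FiniteDimensional ℂ V] (φ : Representation ℂ H V) (hφ : φ.IsIrreducible) :
    ∃ (W : Type u) (_ : AddCommGroup W) (_ : Module ℂ W) (_ : FiniteDimensional ℂ W)
      (σ : Representation ℂ G W), (∀ h : H, σ.character h = φ.character h) ∧
        ∀ g, (∀ x, x⁻¹ * g * x ∉ H) → σ.character g = φ.character 1 := by
  classical
  have hcH : (Nat.card H : ℂ) ≠ 0 := by simp
  let d := finrank ℂ V
  have hd1 : φ.character 1 = d := char_one φ
  have : Invertible (Nat.card H : ℂ) := invertibleOfNonzero hcH
  have : Invertible (Nat.card G : ℂ) := invertibleOfNonzero (by simp)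
  -- Subtracting the degree makes `f` vanish at 1, so that induction followed by restriction returns
  -- `f` on `H`; `F` adds `d` back.
  let f : G → ℂ := fun g => if h : g ∈ H then φ.character ⟨g, h⟩ - d else 0
  have hf : ∀ x ∉ H, f x = 0 := fun x hx => by simp [f, hx]
  have hfH (h : H) : f h = φ.character h - d := by simp [f]
  have hf1 : f 1 = 0 := by simpa [hd1] using hfH 1
  have hfc : ∀ y ∈ H, ∀ x, f (y * x * y⁻¹) = f x := by
    intro y hy x
    by_cases hx : x ∈ H
    · have h1 := hfH ⟨x, hx⟩
      have h2 := hfH (⟨y, hy⟩ * ⟨x, hx⟩ * ⟨y, hy⟩⁻¹)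
      rw [char_conj, ← h1] at h2
      simpa using h2
    · have : y * x * y⁻¹ ∉ H := by
        rwa [H.mul_mem_cancel_right (H.inv_mem hy), H.mul_mem_cancel_left hy]
      rw [hf _ hx, hf _ this]
  have hfinv (g : G) : f g⁻¹ = (starRingEnd ℂ) (f g) := by
    by_cases hg : g ∈ H
    · have h1 := hfH ⟨g, hg⟩
      have h2 := hfH (⟨g, hg⟩⁻¹)
      rw [char_inv_eq_conj] at h2
      simp only [Subgroup.coe_inv] at h1 h2
      rw [h1, h2]
      simp
    · rw [hf _ hg, hf _ (by simpa using hg), map_zero]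
  have hsumH (u : G → ℂ) : ∑ g, f g * u g = ∑ h : H, f h * u h := by
    rw [← Finset.sum_subtype (Finset.univ.filter (· ∈ H)) (by simp) (fun g => f g * u g),
      Finset.sum_filter]
    refine Finset.sum_congr rfl fun g _ => ?_
    split_ifs with hg
    · rfl
    · simp [hf g hg]
  let F : G → ℂ := fun g => ind H f g + d
  have hFH (h : H) : F h = φ.character h := by
    simp only [F]
    rw [ind_apply_of_mem hH hf hf1 hfc h.2, hfH]
    ring
  have hindinv (g : G) : ind H f g⁻¹ = (starRingEnd ℂ) (ind H f g) := by
    simp only [ind, map_mul, map_inv₀, map_natCast, map_sum]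
    congr 1
    refine Finset.sum_congr rfl fun x _ => ?_
    rw [← hfinv]
    congr 1
    group
  have hnormH : ∑ h : H, φ.character h * φ.character h⁻¹ = Nat.card H := by
    have := char_orthonormal φ φ
    rw [if_pos ⟨Representation.Equiv.refl φ⟩, inv_mul_eq_iff_eq_mul₀ hcH] at this
    simpa using this
  -- Reciprocity against `ind H f` itself: induction preserves the norm of `f`, and so `F` inherits
  -- norm one from `φ`.
  have hff : ∑ g, ind H f g * ind H f g⁻¹ =
      (Nat.card H : ℂ)⁻¹ * Fintype.card G * ∑ h : H, f h * f (h⁻¹ : H) := by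
    rw [sum_ind_mul f (ind H f) (fun g y => ind_conj f g y), hsumH]
    congr 1
    refine Finset.sum_congr rfl fun h _ => ?_
    rw [← Subgroup.coe_inv, ind_apply_of_mem hH hf hf1 hfc (h⁻¹).2]
  have hf' : ∑ g, ind H f g = (Nat.card H : ℂ)⁻¹ * Fintype.card G * ∑ h : H, f h := by
    have := sum_ind_mul (H := H) f (fun _ => 1) (fun _ _ => rfl)
    rw [hsumH] at this
    simpa using this
  have hnorm : ∑ g, F g * F g⁻¹ = Fintype.card G := by
    have h1 (g : G) : F g * F g⁻¹ =
        ind H f g * ind H f g⁻¹ + d * ind H f g + d * ind H f g⁻¹ + d * d := by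
      simp only [F]; ring
    have h2 : ∑ g, ind H f g⁻¹ = ∑ g, ind H f g :=
      Fintype.sum_equiv (Equiv.inv G) _ _ fun g => rfl
    have h3 : ∑ h : H, f (h⁻¹ : H) = ∑ h : H, f h :=
      Fintype.sum_equiv (Equiv.inv H) _ _ fun g => rfl
    have h4 (h : H) : φ.character h * φ.character h⁻¹ =
        f h * f (h⁻¹ : H) + d * f h + d * f (h⁻¹ : H) + d * d := by
      rw [hfH, hfH]; ring
    simp only [h4, Finset.sum_add_distrib, ← Finset.mul_sum, h3] at hnormH
    simp only [h1, Finset.sum_add_distrib, ← Finset.mul_sum, h2, hff, hf']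
    simp only [Finset.sum_const, Finset.card_univ, nsmul_eq_mul,
      ← Nat.card_eq_fintype_card] at hnormH ⊢
    field_simp
    linear_combination hnormH
  have hint : ∀ (W : Type u) [AddCommGroup W] [Module ℂ W] [FiniteDimensional ℂ W]
      (σ : Representation ℂ G W), ∃ n : ℤ, ∑ g, F g * σ.character g⁻¹ = n * Fintype.card G := by
    intro W _ _ _ σ
    let τ : Representation ℂ H W := σ.comp H.subtype
    have hτ (h : H) : τ.character h = σ.character h := rfl
    have h1 := card_inv_mul_sum_char_mul_char_eq_finrank τ φ
    have h2 := card_inv_mul_sum_char_eq_finrank τ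
    have h3 := card_inv_mul_sum_char_eq_finrank σ
    rw [inv_mul_eq_iff_eq_mul₀ (by simp)] at h1 h2 h3
    refine ⟨finrank ℂ (IntertwiningMap τ φ) - d * finrank ℂ τ.invariants +
      d * finrank ℂ σ.invariants, ?_⟩
    have h4 : ∑ g, F g * σ.character g⁻¹ =
        ∑ g, ind H f g * σ.character g⁻¹ + d * ∑ g, σ.character g⁻¹ := by
      simp only [F, add_mul, Finset.sum_add_distrib, ← Finset.mul_sum]
    have h5 : ∑ g, σ.character g⁻¹ = ∑ g, σ.character g :=
      Fintype.sum_equiv (Equiv.inv G) _ _ fun g => rfl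
    have h6 : ∑ h, τ.character h⁻¹ = ∑ h, τ.character h :=
      Fintype.sum_equiv (Equiv.inv H) _ _ fun g => rfl
    have h7 : ∑ h : H, f h * σ.character (h : G)⁻¹ =
        ∑ h : H, φ.character h * τ.character h⁻¹ - d * ∑ h, τ.character h⁻¹ := by
      rw [Finset.mul_sum, ← Finset.sum_sub_distrib]
      refine Finset.sum_congr rfl fun h _ => ?_
      rw [hfH, hτ, Subgroup.coe_inv, sub_mul]
    rw [h4, sum_ind_mul f σ.character (fun g y => char_conj σ g y), hsumH, h7, h6, h5, h1, h2, h3]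
    push_cast
    rw [← Nat.card_eq_fintype_card]
    field_simp
  have hd : d ≠ 0 := by
    intro hd0
    have hV : Subsingleton V := finrank_zero_iff.1 hd0
    obtain ⟨a, b, hab⟩ := hφ.toNontrivial
    exact hab (Subrepresentation.toSubmodule_injective (Subsingleton.elim _ _))
  obtain ⟨W, i1, i2, i3, σ, hσ⟩ := exists_char_eq_of_norm_one F
    (fun g => by simp only [F]; rw [hindinv]; simp) hnorm d hd
    (by rw [← hd1, ← hFH 1]; rfl) hint
  refine ⟨W, i1, i2, i3, σ, fun h => by rw [hσ, hFH], fun g hg => ?_⟩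
  rw [hσ, hd1]
  simp only [F]
  rw [ind_apply_of_forall hf hg, zero_add]

/-- An element all of whose powers have trace equal to the dimension acts trivially. -/
theorem apply_eq_one_of_char_eq {W : Type*} [AddCommGroup W] [Module ℂ W] [FiniteDimensional ℂ W]
    (σ : Representation ℂ G W) (g : G)
    (hg : ∀ y ∈ Subgroup.zpowers g, σ.character y = finrank ℂ W) : σ g = 1 := by
  classical
  let C := Subgroup.zpowers g
  have hc : (Nat.card C : ℂ) ≠ 0 := by simp
  have : Invertible (Nat.card C : ℂ) := invertibleOfNonzero hc
  let τ : Representation ℂ C W := σ.comp C.subtype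
  have h := card_inv_mul_sum_char_eq_finrank τ
  have hτ (y : C) : τ.character y = finrank ℂ W := hg y y.2
  simp only [hτ, Finset.sum_const, Finset.card_univ, nsmul_eq_mul,
    ← Nat.card_eq_fintype_card, inv_mul_cancel_left₀ hc] at h
  have htop : τ.invariants = ⊤ :=
    Submodule.eq_top_of_finrank_eq (by exact_mod_cast h.symm)
  ext w
  have hw : w ∈ τ.invariants := htop ▸ Submodule.mem_top
  exact hw ⟨g, Subgroup.mem_zpowers g⟩

/-- Theorem of Frobenius: a Frobenius complement has a normal complement, which consists of the
identity and the elements outside all conjugates of the complement. -/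
theorem exists_normal_complement (hH : IsMalnormal H) :
    ∃ K : Subgroup G, K.Normal ∧ ∀ g, g ∈ K ↔ (g = 1 ∨ ∀ x, x⁻¹ * g * x ∉ H) := by
  classical
  have key : ∀ h : {h : H // h ≠ 1}, ∃ K : Subgroup G, K.Normal ∧ (h.1 : G) ∉ K ∧
      ∀ g, (∀ x, x⁻¹ * g * x ∉ H) → g ∈ K := by
    rintro ⟨h, hh⟩
    obtain ⟨V, i1, i2, i3, φ, hφ, hne⟩ := exists_isIrreducible_char_ne hh
    obtain ⟨W, j1, j2, j3, σ, hσ, hσN⟩ := exists_char_extension hH φ hφ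
    have hone : φ.character 1 = finrank ℂ W := by
      rw [← hσ 1, ← char_one σ]; rfl
    refine ⟨MonoidHom.ker σ, inferInstance, fun hmem => hne ?_, fun g hg => ?_⟩
    · rw [← hσ h, ← hσ 1, character, character, MonoidHom.mem_ker.1 hmem]
      simp
    · refine MonoidHom.mem_ker.2 (apply_eq_one_of_char_eq σ g fun y hy => ?_)
      by_cases hy1 : y = 1
      · rw [hy1, char_one]
      rw [hσN, hone]
      intro x hx
      refine hg x ?_
      -- A conjugate of `g` commutes with the same conjugate of its power `y`. If the latter lies in
      -- `H` and the former does not, malnormality gives `y = 1`.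
      by_contra hgx
      have hcomm : g * y = y * g := by
        obtain ⟨k, rfl⟩ := Subgroup.mem_zpowers_iff.1 hy
        exact ((Commute.refl g).zpow_right k).eq
      have := hH _ hgx _ hx (by
        have : x⁻¹ * g * x * (x⁻¹ * y * x) * (x⁻¹ * g * x)⁻¹ = x⁻¹ * y * x := by
          have : x⁻¹ * g * x * (x⁻¹ * y * x) * (x⁻¹ * g * x)⁻¹ = x⁻¹ * (g * y) * g⁻¹ * x := by
            group
          rw [this, hcomm]
          group
        rwa [this])
      apply hy1
      have h2 : y = x * (x⁻¹ * y * x) * x⁻¹ := by group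
      rw [h2, this]
      group
  choose K hKn hKh hKN using key
  have hn : (⨅ h, K h).Normal := Subgroup.normal_iInf_normal hKn
  refine ⟨⨅ h, K h, hn, fun g => ⟨fun hg => ?_, ?_⟩⟩
  · by_contra! hcon
    obtain ⟨hg1, x, hx⟩ := hcon
    have hne : (⟨x⁻¹ * g * x, hx⟩ : H) ≠ 1 := by
      intro h
      have h' : x⁻¹ * g * x = 1 := congrArg Subtype.val h
      apply hg1
      have h2 : g = x * (x⁻¹ * g * x) * x⁻¹ := by group
      rw [h2, h']
      group
    have hmem := hn.conj_mem g hg x⁻¹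
    rw [inv_inv] at hmem
    exact hKh ⟨⟨_, hx⟩, hne⟩ (Subgroup.mem_iInf.1 hmem _)
  · rintro (rfl | hg)
    · exact Subgroup.one_mem _
    · exact Subgroup.mem_iInf.2 fun h => hKN h g hg

end Frobenius

/-! ### Camina kernels of Frobenius and extra-special groups -/

namespace Frobenius

variable {G : Type*} [Group G] [Fintype G] {H : Subgroup G}

/-- The conjugates of a proper malnormal subgroup do not cover the group. -/
theorem exists_forall_conj_notMem (hH : IsMalnormal H) (htop : H ≠ ⊤) :
    ∃ g : G, g ≠ 1 ∧ ∀ x, x⁻¹ * g * x ∉ H := by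
  classical
  by_contra! hcon
  -- If the conjugates covered `G`, inducing the indicator of `H \ {1}` would give that of `G \
  -- {1}`. Summing over `G` then yields `|H| = |G|`.
  let f : G → ℂ := fun g => if g ∈ H ∧ g ≠ 1 then 1 else 0
  have hf : ∀ x ∉ H, f x = 0 := fun x hx => by simp [f, hx]
  have hf1 : f 1 = 0 := by simp [f]
  have hfc : ∀ y ∈ H, ∀ x, f (y * x * y⁻¹) = f x := by
    intro y hy x
    have h1 : y * x * y⁻¹ ∈ H ↔ x ∈ H := by
      rw [H.mul_mem_cancel_right (H.inv_mem hy), H.mul_mem_cancel_left hy]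
    have h2 : y * x * y⁻¹ = 1 ↔ x = 1 := conj_eq_one_iff
    simp only [f, h1, ne_eq, h2]
  have hind (g : G) : ind H f g = 1 - if g = 1 then 1 else 0 := by
    split_ifs with hg
    · rw [hg, ind_apply_of_mem hH hf hf1 hfc H.one_mem, hf1, sub_self]
    · obtain ⟨x, hx⟩ := hcon g hg
      have h1 := ind_conj (H := H) f g x⁻¹
      rw [inv_inv, ind_apply_of_mem hH hf hf1 hfc hx] at h1
      have hne : x⁻¹ * g * x ≠ 1 := by
        have := (conj_eq_one_iff (a := x⁻¹) (b := g)).not.2 hg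
        rwa [inv_inv] at this
      rw [← h1]
      simp [f, hx, hne]
  have hsum := sum_ind_mul (H := H) f (fun _ => 1) (fun _ _ => rfl)
  have hfg (g : G) : f g = (if g ∈ H then 1 else 0) - if g = 1 then 1 else 0 := by
    by_cases h1 : g = 1
    · simp [f, h1, H.one_mem]
    · simp [f, h1]
  have hcard : (Finset.univ.filter (· ∈ H)).card = Nat.card H := by
    rw [Nat.card_eq_fintype_card, Fintype.card_subtype]
  have hcH : (Nat.card H : ℂ) ≠ 0 := by simp
  simp only [mul_one, hind, hfg, Finset.sum_sub_distrib, Finset.sum_ite_eq', Finset.mem_univ,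
    if_true, Finset.sum_const, Finset.card_univ, nsmul_eq_mul, Finset.sum_boole, hcard,
    ← Nat.card_eq_fintype_card] at hsum
  apply htop
  apply Subgroup.eq_top_of_card_eq
  field_simp at hsum
  have : (Nat.card H : ℂ) = Nat.card G := by linear_combination -hsum
  exact_mod_cast this

theorem exists_isCaminaKernel (hH : IsMalnormal H) (hbot : H ≠ ⊥) (htop : H ≠ ⊤) :
    ∃ N : Subgroup G, IsCaminaKernel N := by
  obtain ⟨K, hK, hmem⟩ := exists_normal_complement hH
  refine ⟨K, hK, ?_, ?_, fun x hx n hn => ?_⟩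
  · rintro rfl
    obtain ⟨g, hg1, hg⟩ := exists_forall_conj_notMem hH htop
    exact hg1 (Subgroup.mem_bot.1 ((hmem g).2 (Or.inr hg)))
  · rintro rfl
    obtain ⟨h, hh, h1⟩ := H.bot_or_exists_ne_one.resolve_left hbot
    rcases (hmem h).1 (Subgroup.mem_top h) with h' | h'
    · exact h1 h'
    · exact h' 1 (by simpa using hh)
  · have hx' := (hmem x).not.1 hx
    push Not at hx'
    obtain ⟨hx1, y, hy⟩ := hx'
    have hcent : ∀ c ∈ K, c * x = x * c → c = 1 := by
      intro c hc hcx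
      refine ((hmem c).1 hc).resolve_right fun hcon => ?_
      have heq : y⁻¹ * c * y * (y⁻¹ * x * y) * (y⁻¹ * c * y)⁻¹ = y⁻¹ * x * y := by
        have h1 : y⁻¹ * c * y * (y⁻¹ * x * y) * (y⁻¹ * c * y)⁻¹ = y⁻¹ * (c * x) * c⁻¹ * y := by
          group
        rw [h1, hcx]
        group
      have h2 := hH _ (hcon y) _ hy (by rwa [heq])
      have h3 := (conj_eq_one_iff (a := y⁻¹) (b := x)).not.2 hx1
      rw [inv_inv] at h3
      exact h3 h2
    -- The commutator map `k ↦ [k, x]` is injective because `x` centralizes no nontrivial element of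
    -- `K`; finiteness makes it surjective.
    let ψ : K → K := fun k =>
      ⟨k * (x * (k : G)⁻¹ * x⁻¹), K.mul_mem k.2 (hK.conj_mem _ (K.inv_mem k.2) x)⟩
    have hψ : Function.Injective ψ := by
      rintro ⟨a, ha⟩ ⟨b, hb⟩ hab
      have hab' : a * (x * a⁻¹ * x⁻¹) = b * (x * b⁻¹ * x⁻¹) := congrArg Subtype.val hab
      have h1 := hcent (b⁻¹ * a) (K.mul_mem (K.inv_mem hb) ha) (by
        have h2 : b⁻¹ * a * x = b⁻¹ * (a * (x * a⁻¹ * x⁻¹)) * x * a := by group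
        rw [h2, hab']
        group)
      exact Subtype.ext (inv_mul_eq_one.1 h1).symm
    obtain ⟨k, hk⟩ := (Finite.injective_iff_surjective.1 hψ) ⟨n, hn⟩
    have hk' : k * (x * (k : G)⁻¹ * x⁻¹) = n := congrArg Subtype.val hk
    rw [isConj_iff]
    refine ⟨k, ?_⟩
    rw [← hk']
    group

end Frobenius

theorem IsFrobeniusGroup.exists_isCaminaKernel {G : Type*} [Group G] [Fintype G]
    (hG : IsFrobeniusGroup G) : ∃ N : Subgroup G, IsCaminaKernel N := by
  obtain ⟨H, hbot, htop, hH⟩ := hG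
  exact Frobenius.exists_isCaminaKernel hH hbot htop

/-- Since commutators are central, `g ↦ [g, x]` is a homomorphism to the center. It is nontrivial
for noncentral `x`, hence onto a group of prime order. -/
theorem IsExtraSpecial.isCaminaKernel_center {G : Type*} [Group G] (hG : IsExtraSpecial G) :
    IsCaminaKernel (Subgroup.center G) := by
  obtain ⟨p, hp, -, hcard, hnt, hcomm, -⟩ := hG
  have : Fact (Nat.card (Subgroup.center G)).Prime := ⟨hcard ▸ hp⟩
  refine ⟨inferInstance, ?_, ?_, fun x hx n hn => ?_⟩
  · intro h
    have h1 := hp.one_lt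
    rw [← hcard, h, Subgroup.card_bot] at h1
    exact lt_irrefl _ h1
  · intro h
    exact not_subsingleton (G ⧸ Subgroup.center G)
      (QuotientGroup.subsingleton_iff.2 h)
  · have hmem (g : G) : g * x * g⁻¹ * x⁻¹ ∈ Subgroup.center G := by
      rw [← QuotientGroup.eq_one_iff]
      simp only [QuotientGroup.mk_mul, QuotientGroup.mk_inv]
      rw [hcomm (g : G ⧸ Subgroup.center G) x, mul_inv_cancel_right, mul_inv_cancel]
    let ψ : G →* Subgroup.center G :=
      { toFun := fun g => ⟨g * x * g⁻¹ * x⁻¹, hmem g⟩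
        map_one' := Subtype.ext (by simp)
        map_mul' := fun g h => Subtype.ext (by
          have h1 := Subgroup.mem_center_iff.1 (hmem h) g
          calc g * h * x * (g * h)⁻¹ * x⁻¹
              = (g * (h * x * h⁻¹ * x⁻¹)) * x * g⁻¹ * x⁻¹ := by group
            _ = (h * x * h⁻¹ * x⁻¹) * (g * x * g⁻¹ * x⁻¹) := by rw [h1]; group
            _ = (g * x * g⁻¹ * x⁻¹) * (h * x * h⁻¹ * x⁻¹) :=
                (Subgroup.mem_center_iff.1 (hmem g) _)) }
    have hrange : ψ.range = ⊤ := by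
      refine ψ.range.eq_bot_or_eq_top_of_prime_card.resolve_left fun hbot => hx ?_
      rw [Subgroup.mem_center_iff]
      intro g
      have h1 : ψ g = 1 := by
        have : ψ g ∈ ψ.range := ⟨g, rfl⟩
        rwa [hbot, Subgroup.mem_bot] at this
      have h2 : g * x * g⁻¹ * x⁻¹ = 1 := congrArg Subtype.val h1
      rw [mul_inv_eq_one, mul_inv_eq_iff_eq_mul] at h2
      exact h2
    obtain ⟨g, hg⟩ : (⟨n, hn⟩ : Subgroup.center G) ∈ ψ.range := hrange ▸ Subgroup.mem_top _
    have hg' : g * x * g⁻¹ * x⁻¹ = n := congrArg Subtype.val hg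
    rw [isConj_iff]
    exact ⟨g, by rw [← hg']; group⟩

/-! ### Structure constants and basic sets of S-rings -/

section GroupRingSum

variable {G : Type*} [Group G] [DecidableEq G]

theorem coeff_groupRingSum (X : Finset G) (g : G) :
    (groupRingSum X).coeff g = if g ∈ X then 1 else 0 := by
  simp [groupRingSum, MonoidAlgebra.of_apply, Finsupp.single_apply]

theorem coeff_groupRingSum_mul (Z X : Finset G) (g : G) :
    (groupRingSum Z * groupRingSum X).coeff g = (Z.filter fun z => z⁻¹ * g ∈ X).card := by
  rw [groupRingSum, Finset.sum_mul]
  simp [MonoidAlgebra.of_apply, coeff_groupRingSum]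

end GroupRingSum

namespace SchurRing

variable {G : Type*} [Group G] [Fintype G] [DecidableEq G] (A : SchurRing G)

theorem groupRingSum_mem {X : Finset G} (hX : X ∈ A.basicSets.parts) :
    groupRingSum X ∈ A.toSubring := by
  have : groupRingSum X ∈ (A.toSubring : Set (MonoidAlgebra ℤ G)) := by
    rw [← A.span_eq]
    exact Submodule.subset_span ⟨X, hX, rfl⟩
  exact this

theorem eq_of_mem_of_mem {X Y : Finset G} (hX : X ∈ A.basicSets.parts)
    (hY : Y ∈ A.basicSets.parts) {g : G} (hgX : g ∈ X) (hgY : g ∈ Y) : X = Y := by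
  rw [← A.basicSets.part_eq_of_mem hX hgX, A.basicSets.part_eq_of_mem hY hgY]

theorem exists_basicSet_mem (g : G) : ∃ X ∈ A.basicSets.parts, g ∈ X :=
  A.basicSets.exists_mem (Finset.mem_univ g)

/-- Elements of a Schur ring have constant coefficients on basic sets. -/
theorem coeff_eq {a : MonoidAlgebra ℤ G} (ha : a ∈ A.toSubring) {X : Finset G}
    (hX : X ∈ A.basicSets.parts) {g g' : G} (hg : g ∈ X) (hg' : g' ∈ X) :
    a.coeff g = a.coeff g' := by
  have ha' : a ∈ Submodule.span ℤ {a | ∃ X ∈ A.basicSets.parts, a = groupRingSum X} := by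
    rw [← SetLike.mem_coe, A.span_eq]
    exact ha
  clear ha
  induction ha' using Submodule.span_induction with
  | mem x hx =>
    obtain ⟨Y, hY, rfl⟩ := hx
    have : g ∈ Y ↔ g' ∈ Y :=
      ⟨fun h => A.eq_of_mem_of_mem hX hY hg h ▸ hg', fun h => A.eq_of_mem_of_mem hX hY hg' h ▸ hg⟩
    simp only [coeff_groupRingSum, this]
  | zero => rfl
  | add x y _ _ ihx ihy => simp [ihx, ihy]
  | smul c x _ ih => simp only [MonoidAlgebra.coeff_smul, Finsupp.smul_apply, ih]

/-- The structure constants of a Schur ring are well defined. -/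
theorem card_filter_eq {Z X Y : Finset G} (hZ : Z ∈ A.basicSets.parts)
    (hX : X ∈ A.basicSets.parts) (hY : Y ∈ A.basicSets.parts) {g g' : G} (hg : g ∈ Y)
    (hg' : g' ∈ Y) :
    (Z.filter fun z => z⁻¹ * g ∈ X).card = (Z.filter fun z => z⁻¹ * g' ∈ X).card := by
  have := A.coeff_eq (A.toSubring.mul_mem (A.groupRingSum_mem hZ) (A.groupRingSum_mem hX)) hY hg hg'
  rw [coeff_groupRingSum_mul, coeff_groupRingSum_mul] at this
  exact_mod_cast this

theorem isASet_of_forall {S : Set G}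
    (hS : ∀ X ∈ A.basicSets.parts, ∀ x ∈ X, x ∈ S → ∀ y ∈ X, y ∈ S) : A.IsASet S := by
  classical
  refine ⟨A.basicSets.parts.filter fun X => ∀ x ∈ X, x ∈ S, Finset.filter_subset _ _, ?_⟩
  ext g
  simp only [Finset.mem_filter, Set.mem_iUnion, Finset.mem_coe, exists_prop]
  constructor
  · intro hg
    obtain ⟨X, hX, hgX⟩ := A.exists_basicSet_mem g
    exact ⟨X, ⟨hX, hS X hX g hgX hg⟩, hgX⟩
  · rintro ⟨X, ⟨-, h⟩, hg⟩
    exact h g hg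

variable {A}

theorem IsCentral.mem_of_isConj (hA : A.IsCentral) {X : Finset G} (hX : X ∈ A.basicSets.parts)
    {x y : G} (hx : x ∈ X) (hxy : IsConj x y) : y ∈ X := by
  obtain ⟨c, rfl⟩ := isConj_iff.1 hxy
  -- At `c * x` the two products have as coefficients those of `X` at `x` and at `c * x * c⁻¹`.
  have h := Subring.mem_center_iff.1 (hA (A.groupRingSum_mem hX)) (MonoidAlgebra.single c 1)
  have h1 := congrArg (fun a : MonoidAlgebra ℤ G => a.coeff (c * x)) h
  simpa [coeff_groupRingSum, hx] using h1

/-! ### Primitive central S-rings in the presence of a Camina kernel -/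

section Camina

variable {N : Subgroup G}

theorem IsCentral.mul_mem (hN : IsCaminaKernel N) (hA : A.IsCentral) {X : Finset G}
    (hX : X ∈ A.basicSets.parts) {n x : G} (hx : x ∈ X) (hxN : x ∉ N) (hn : n ∈ N) : n * x ∈ X :=
  hA.mem_of_isConj hX hx (hN.isConj x hxN n hn)

theorem IsCentral.mul_mem' (hN : IsCaminaKernel N) (hA : A.IsCentral) {X : Finset G}
    (hX : X ∈ A.basicSets.parts) {n x : G} (hx : x ∈ X) (hxN : x ∉ N) (hn : n ∈ N) :
    x * n ∈ X := by
  have h := hA.mul_mem hN hX hx hxN (hN.normal.conj_mem n hn x)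
  rwa [inv_mul_cancel_right] at h

theorem eq_singleton_one {X : Finset G} (hX : X ∈ A.basicSets.parts) (h1 : (1 : G) ∈ X) :
    X = {1} :=
  A.eq_of_mem_of_mem hX A.one_mem h1 (Finset.mem_singleton_self 1)

/-- The union of the basic sets contained in a given subgroup is a subgroup. -/
def core (A : SchurRing G) (N : Subgroup G) : Subgroup G where
  carrier := {g | ∀ X ∈ A.basicSets.parts, g ∈ X → ∀ x ∈ X, x ∈ N}
  one_mem' X hX h1 x hx := by
    rw [eq_singleton_one hX h1, Finset.mem_singleton] at hx
    exact hx ▸ N.one_mem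
  mul_mem' {a b} ha hb Y hY hab y hy := by
    obtain ⟨Z, hZ, haZ⟩ := A.exists_basicSet_mem a
    obtain ⟨X, hX, hbX⟩ := A.exists_basicSet_mem b
    -- The factorization of `a * b` makes a structure constant positive, so every `y` in the same
    -- basic set also factors through `Z` and `X`.
    have hpos : 0 < (Z.filter fun z => z⁻¹ * y ∈ X).card := by
      rw [← A.card_filter_eq hZ hX hY hab hy, Finset.card_pos]
      exact ⟨a, Finset.mem_filter.2 ⟨haZ, by simpa using hbX⟩⟩
    obtain ⟨z, hz⟩ := Finset.card_pos.1 hpos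
    rw [Finset.mem_filter] at hz
    have := N.mul_mem (ha Z hZ haZ z hz.1) (hb X hX hbX _ hz.2)
    rwa [mul_inv_cancel_left] at this
  inv_mem' {a} ha X hX haX x hx := by
    have := ha X⁻¹ (A.inv_mem X hX) (by simpa using haX) x⁻¹ (by simpa using hx)
    simpa using this

/-- Otherwise `core A N` is a proper `A`-subgroup containing `X`, hence nontrivial. -/
theorem exists_mem_notMem (hprim : A.IsPrimitive) (hN : N ≠ ⊤) {X : Finset G}
    (hX : X ∈ A.basicSets.parts) (hX1 : X ≠ {1}) : ∃ x ∈ X, x ∉ N := by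
  by_contra! hcon
  have hmem : ∀ {g : G}, g ∈ A.core N ↔ ∀ X ∈ A.basicSets.parts, g ∈ X → ∀ x ∈ X, x ∈ N := Iff.rfl
  have hA : A.IsASet (A.core N : Set G) := by
    refine A.isASet_of_forall fun Y hY x hx hxc y hy => ?_
    rw [SetLike.mem_coe, hmem] at hxc ⊢
    intro Z hZ hyZ z hz
    obtain rfl := A.eq_of_mem_of_mem hY hZ hy hyZ
    exact hxc Y hY hx z hz
  have hXc : ∀ x ∈ X, x ∈ A.core N := by
    intro x hx
    rw [hmem]
    intro Z hZ hxZ z hz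
    obtain rfl := A.eq_of_mem_of_mem hX hZ hx hxZ
    exact hcon z hz
  rcases hprim _ hA with h | h
  · obtain ⟨x, hx⟩ := A.basicSets.nonempty_of_mem_parts hX
    have := hXc x hx
    rw [h, Subgroup.mem_bot] at this
    exact hX1 (eq_singleton_one hX (this ▸ hx))
  · apply hN
    rw [eq_top_iff]
    intro g _
    obtain ⟨Y, hY, hgY⟩ := A.exists_basicSet_mem g
    have hg : g ∈ A.core N := h ▸ Subgroup.mem_top g
    exact hmem.1 hg Y hY hgY g hgY

/-- The left radical of a basic set is an `A`-subgroup. -/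
theorem isASet_stabilizer {X : Finset G} (hX : X ∈ A.basicSets.parts) :
    A.IsASet (MulAction.stabilizer G X : Set G) := by
  refine A.isASet_of_forall fun Y hY g hg hgR g' hg' => ?_
  -- At `g` in the stabilizer this structure constant attains its maximum `|X|`; attaining it at
  -- `g'` too means that `g'` stabilizes `X`.
  have hcard := A.card_filter_eq hX (A.inv_mem X hX) hY hg hg'
  have hg1 : (X.filter fun z => z⁻¹ * g ∈ X⁻¹) = X := by
    refine Finset.filter_true_of_mem fun z hz => ?_
    have h1 : g • X = X := hgR
    rw [← h1, Finset.mem_smul_finset] at hz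
    obtain ⟨y, hy, rfl⟩ := hz
    simpa using hy
  rw [hg1] at hcard
  have h2 : (X.filter fun z => z⁻¹ * g' ∈ X⁻¹) = X :=
    Finset.eq_of_subset_of_card_le (Finset.filter_subset _ _) hcard.le
  rw [SetLike.mem_coe, ← inv_mem_iff, MulAction.mem_stabilizer_iff]
  refine Finset.eq_of_subset_of_card_le ?_ (by simp)
  intro w hw
  obtain ⟨z, hz, rfl⟩ := Finset.mem_smul_finset.1 hw
  rw [← h2] at hz
  have := (Finset.mem_filter.1 hz).2
  simpa using this

/-- Otherwise `X` is a union of `N`-cosets, so its stabilizer contains `N` and is all of `G` by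
primitivity. Then `X` contains 1, which lies in `N`. -/
theorem exists_mem_mem (hN : IsCaminaKernel N) (hA : A.IsCentral) (hprim : A.IsPrimitive)
    {X : Finset G} (hX : X ∈ A.basicSets.parts) : ∃ x ∈ X, x ∈ N := by
  by_contra! hcon
  rcases hprim _ (isASet_stabilizer hX) with h | h
  · apply hN.ne_bot
    rw [eq_bot_iff, ← h]
    intro n hn
    rw [MulAction.mem_stabilizer_iff]
    refine Finset.eq_of_subset_of_card_le ?_ (by simp)
    intro w hw
    obtain ⟨x, hx, rfl⟩ := Finset.mem_smul_finset.1 hw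
    exact hA.mul_mem hN hX hx (hcon x hx) hn
  · obtain ⟨x, hx⟩ := A.basicSets.nonempty_of_mem_parts hX
    have hxs : x⁻¹ ∈ MulAction.stabilizer G X := h ▸ Subgroup.mem_top _
    rw [MulAction.mem_stabilizer_iff] at hxs
    have h1 : (1 : G) ∈ X := by
      rw [← hxs, Finset.mem_smul_finset]
      exact ⟨x, hx, by simp⟩
    exact hcon 1 h1 N.one_mem

/-- The coefficient of the product of `Z` and `X` is the same at `x` and at some `g ∈ X` outside
`N`. At `g` all of `Z ∩ N` contributes, since `X` absorbs `N` there. At `x` only elements of `Z ∩ N`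
can contribute, so all of them do. -/
theorem inv_mul_mem (hN : IsCaminaKernel N) (hA : A.IsCentral) (hprim : A.IsPrimitive)
    {X Z : Finset G} (hX : X ∈ A.basicSets.parts) (hX1 : X ≠ {1}) (hZ : Z ∈ A.basicSets.parts)
    (hZX : Z ≠ X⁻¹) {x z : G} (hx : x ∈ X) (hxN : x ∈ N) (hz : z ∈ Z) (hzN : z ∈ N) :
    z⁻¹ * x ∈ X := by
  classical
  obtain ⟨g, hg, hgN⟩ := exists_mem_notMem hprim hN.ne_top hX hX1
  have hsub₁ : (Z.filter fun z => z ∈ N) ⊆ Z.filter fun z => z⁻¹ * g ∈ X := by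
    intro w hw
    rw [Finset.mem_filter] at hw ⊢
    exact ⟨hw.1, hA.mul_mem hN hX hg hgN (N.inv_mem hw.2)⟩
  have hsub₂ : (Z.filter fun z => z⁻¹ * x ∈ X) ⊆ Z.filter fun z => z ∈ N := by
    intro w hw
    rw [Finset.mem_filter] at hw ⊢
    refine ⟨hw.1, ?_⟩
    -- A contribution `w ∉ N` would put the whole coset of `w⁻¹` in `X`, forcing `Z = X⁻¹`.
    by_contra hwN
    have h1 : w⁻¹ * x ∉ N := by
      rwa [N.mul_mem_cancel_right hxN, inv_mem_iff]
    have h2 := hA.mul_mem' hN hX hw.2 h1 (N.inv_mem hxN)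
    rw [mul_inv_cancel_right] at h2
    exact hZX (A.eq_of_mem_of_mem hZ (A.inv_mem X hX) hw.1 (by simpa using h2))
  have hcard := A.card_filter_eq hZ hX hX hg hx
  have heq := Finset.eq_of_subset_of_card_le hsub₂ (hcard ▸ Finset.card_le_card hsub₁)
  have : z ∈ Z.filter fun z => z ∈ N := Finset.mem_filter.2 ⟨hz, hzN⟩
  rw [← heq] at this
  exact (Finset.mem_filter.1 this).2

/-- A primitive central Schur ring over a group with a Camina kernel has at most one nontrivial
basic set. -/
theorem eq_of_ne_singleton_one (hN : IsCaminaKernel N) (hA : A.IsCentral) (hprim : A.IsPrimitive)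
    {X Z : Finset G} (hX : X ∈ A.basicSets.parts) (hX1 : X ≠ {1}) (hZ : Z ∈ A.basicSets.parts)
    (hZ1 : Z ≠ {1}) : X = Z := by
  have hsymm {Y : Finset G} (hY : Y ∈ A.basicSets.parts) (hY1 : Y ≠ {1}) : Y = Y⁻¹ := by
    by_contra hne
    obtain ⟨y, hy, hyN⟩ := exists_mem_mem hN hA hprim hY
    -- Taking both basic sets equal to `Y` and both points equal to `y` would place 1 in `Y`.
    have := inv_mul_mem hN hA hprim hY hY1 hY hne hy hyN hy hyN
    rw [inv_mul_cancel] at this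
    exact hY1 (eq_singleton_one hY this)
  by_contra hne
  obtain ⟨x, hx, hxN⟩ := exists_mem_mem hN hA hprim hX
  obtain ⟨z, hz, hzN⟩ := exists_mem_mem hN hA hprim hZ
  have h1 := inv_mul_mem hN hA hprim hX hX1 hZ (hsymm hX hX1 ▸ Ne.symm hne) hx hxN hz hzN
  have h2 := inv_mul_mem hN hA hprim hZ hZ1 hX (hsymm hZ hZ1 ▸ hne) hz hzN hx hxN
  -- By symmetry of `Z`, the element `z⁻¹ * x` lies in both `X` and `Z`.
  have h3 : z⁻¹ * x ∈ Z := by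
    rw [hsymm hZ hZ1, Finset.mem_inv']
    simpa using h2
  exact hne (A.eq_of_mem_of_mem hX hZ h1 h3)

end Camina

theorem toSubring_subset_span_of_forall_eq
    (h : ∀ X ∈ A.basicSets.parts, ∀ Z ∈ A.basicSets.parts, X ≠ {1} → Z ≠ {1} → X = Z) :
    (A.toSubring : Set (MonoidAlgebra ℤ G)) ⊆
      (Submodule.span ℤ {1, groupRingSum (Finset.univ : Finset G)} : Set (MonoidAlgebra ℤ G)) := by
  rw [← A.span_eq, SetLike.coe_subset_coe, Submodule.span_le]
  rintro _ ⟨X, hX, rfl⟩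
  rw [SetLike.mem_coe]
  have hone : groupRingSum ({1} : Finset G) = 1 := by
    simp [groupRingSum, MonoidAlgebra.one_def]
  have h1 : (1 : MonoidAlgebra ℤ G) ∈
      Submodule.span ℤ {1, groupRingSum (Finset.univ : Finset G)} :=
    Submodule.subset_span (by simp)
  by_cases hX1 : X = {1}
  · rwa [hX1, hone]
  have hXeq : X = Finset.univ \ {1} := by
    ext g
    simp only [Finset.mem_sdiff, Finset.mem_univ, true_and, Finset.mem_singleton]
    constructor
    · rintro hg rfl
      exact hX1 (eq_singleton_one hX hg)
    · intro hg
      obtain ⟨Y, hY, hgY⟩ := A.exists_basicSet_mem g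
      have hY1 : Y ≠ {1} := by
        rintro rfl
        exact hg (Finset.mem_singleton.1 hgY)
      rwa [h X hX Y hY hX1 hY1]
  have hsum : groupRingSum X = groupRingSum Finset.univ - 1 := by
    rw [hXeq, ← hone, eq_sub_iff_add_eq]
    exact Finset.sum_sdiff (Finset.subset_univ _)
  rw [hsum]
  exact Submodule.sub_mem _ (Submodule.subset_span (by simp)) h1

end SchurRing

/-- The contradiction is with the strict lower inclusion in properness: the S-ring is contained in
the trivial one. -/
theorem IsCaminaKernel.isGeneralizedBGroup {G : Type*} [Group G] [Fintype G] [DecidableEq G]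
    {N : Subgroup G} (hN : IsCaminaKernel N) : IsGeneralizedBGroup G := fun _ hA hproper hprim =>
  hproper.1.2 (SchurRing.toSubring_subset_span_of_forall_eq fun _ hX _ hZ hX1 hZ1 =>
    SchurRing.eq_of_ne_singleton_one hN hA hprim hX hX1 hZ hZ1)

theorem mainTheorem5 (G : Type*) [Group G] [Fintype G] [DecidableEq G]
    (hG : IsFrobeniusGroup G ∨ IsExtraSpecial G) : IsGeneralizedBGroup G := by
  rcases hG with hG | hG
  · obtain ⟨N, hN⟩ := hG.exists_isCaminaKernel
    exact hN.isGeneralizedBGroup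
  · exact hG.isCaminaKernel_center.isGeneralizedBGroup
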